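/- Let $d\ge 1$. A lattice polytope in $\mathbb R^d$ is the convex hull of finitely many points of $\mathbb Z^d$; an IP polytope is a lattice polytope whose only interior lattice point is $0$. For $\Delta\subset\mathbb R^d$ let $\Delta^*=\{y\in\mathbb R^d : y\cdot x\ge -1\ \forall x\in\Delta\}$ and $\widetilde\Delta=\mathrm{ConvHull}(\Delta^*\cap\mathbb Z^d)$. An IP polytope $\Delta$ is reflexive if $\Delta^*$ is a lattice polytope; it is IP-confined if $\widetilde\Delta$ is a lattice polytope with $0$ in its interior; and an IP-confined polytope is IPC-closed if $\Delta=\widetilde{\widetilde\Delta}$. A maximal IPC-closed polytope is one that is maximal with respect to inclusion among the IPC-closed polytopes in $\mathbb R^d$. An IP polytope is minimal if, after removal of any one of its vertices, the convex hull of the remaining vertices no longer has $0$ in its interior. A weight matrix (in dimension $d$) is an $I\times J$ matrix $W$ of non-negative integers with linearly independent rows, no zero column and $J=I+d$, for which there is a minimal IP polytope in $\mathbb R^d$ with exactly $J$ vertices $v_1,\dots,v_J\in\mathbb Z^d$ such that for every $i$ the points $v_j$ with $W_{ij}\neq0$ are affinely independent (the vertices of a simplex), $\sum_jW_{ij}v_j=0$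 and $\gcd_j(W_{ij})=1$. Let $D_i=\sum_jW_{ij}$ and let $\Delta(W)$ be the Newton polytope of a generic polynomial of multidegree $(D_i)$, i.e. the convex hull of all $m\in\mathbb Z_{\ge0}^J$ with $\sum_jW_{ij}m_j=D_i$ for all $i$. Its natural lattice is the set of $m\in\mathbb Z^J$ with $\sum_j W_{ij}m_j=D_i$ for all $i$, with origin $\mathbf 1=(1,\dots,1)$, and interiors of polytopes in the affine space $A_W=\{x\in\mathbb R^J:\sum_jW_{ij}x_j=D_i\ \forall i\}$ are taken relative to $A_W$. $W$ is an IP weight matrix if exactly one point of the natural lattice lies in the interior of $\Delta(W)$. Then every IP-confined polytope in $\mathbb R^d$ is contained in a maximal IPC-closed polytope. Every reflexive polytope is IP-confined, and hence is also contained in a maximal IPC-closed polytope. Moreover, for every maximal IPC-closed polytope $\Delta_M\subset\mathbb R^d$ there are an IP weight matrix $W$ in dimension $d$ with $\mathrm{rank}(W)\le d$ and a sublattice $\Gamma$ of the natural lattice of $\Delta(W)$ (containing the origin $\mathbf 1$), such that $\mathrm{ConvHull}(\Delta(W)\cap\Gamma)$ has exactly one point of $\Gamma$ in its interior and $$\Delta_M=\mathrm{ConvHull}(\Delta(W)\cap\Gamma)$$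 up to an injective affine map $\mathbb R^d\to\mathbb R^J$ that maps $0$ to $\mathbf 1$ and $\mathbb Z^d$ onto $\Gamma$. -/

import Mathlib

open scoped Matrix Topology

namespace IPC

/-- The inclusion of `ℤᵈ` into `ℝᵈ`. -/
def toReal {d : ℕ} (z : Fin d → ℤ) : Fin d → ℝ := fun i => (z i : ℝ)

/-- The lattice `ℤᵈ` inside `ℝᵈ`. -/
def latticePoints (d : ℕ) : Set (Fin d → ℝ) := Set.range (toReal (d := d))

/-- `P` is a lattice polytope for `L`: the convex hull of a finite subset of `L`. -/
def IsLatticePolytope {d : ℕ} (L P : Set (Fin d → ℝ)) : Prop :=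
  ∃ s : Finset (Fin d → ℝ), (s : Set (Fin d → ℝ)) ⊆ L ∧ P = convexHull ℝ (s : Set (Fin d → ℝ))

/-- An IP polytope in `ℝᵈ`: a lattice polytope whose only interior lattice point is the origin. -/
def IsIPPolytope {d : ℕ} (P : Set (Fin d → ℝ)) : Prop :=
  IsLatticePolytope (latticePoints d) P ∧ interior P ∩ latticePoints d = {0}

/-- The polar `P* = {y | y ⬝ x ≥ -1 for all x ∈ P}`. -/
def polar {d : ℕ} (P : Set (Fin d → ℝ)) : Set (Fin d → ℝ) :=
  {y | ∀ x ∈ P, -1 ≤ y ⬝ᵥ x}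

/-- A reflexive polytope: an IP polytope whose polar is a lattice polytope. -/
def IsReflexive {d : ℕ} (P : Set (Fin d → ℝ)) : Prop :=
  IsIPPolytope P ∧ IsLatticePolytope (latticePoints d) (polar P)

/-- The generalized dual: the convex hull of the lattice points of the polar. -/
def ipDual {d : ℕ} (P : Set (Fin d → ℝ)) : Set (Fin d → ℝ) :=
  convexHull ℝ (polar P ∩ latticePoints d)

/-- An IP polytope is IP-confined if its generalized dual is again a lattice polytope with the
origin in its interior (so that the generalized dual of the latter is defined). -/
def IsIPConfined {d : ℕ} (P : Set (Fin d → ℝ)) : Prop :=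
  IsIPPolytope P ∧ IsLatticePolytope (latticePoints d) (ipDual P) ∧ 0 ∈ interior (ipDual P)

/-- An IP-confined polytope is IPC-closed if it agrees with its generalized double dual. -/
def IsIPCClosed {d : ℕ} (P : Set (Fin d → ℝ)) : Prop :=
  IsIPConfined P ∧ P = ipDual (ipDual P)

/-- A minimal IP polytope: after removal of any vertex, the convex hull of the remaining
vertices no longer has the origin in its interior. -/
def IsMinimalIPPolytope {d : ℕ} (P : Set (Fin d → ℝ)) : Prop :=
  IsIPPolytope P ∧
    ∀ v ∈ P.extremePoints ℝ, (0 : Fin d → ℝ) ∉ interior (convexHull ℝ (P.extremePoints ℝ \ {v}))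

/-- `W`, with `r` rows and `n` columns, is a weight matrix in dimension `d = n - r`: it records the
linear relations of a minimal IP polytope in `ℝᵈ` with `n` vertices `v j`, written as the hull of
`r` simplices that contain the origin in their relative interiors.  Row `i` is the weight vector of
the `i`-th simplex (positive integers without common divisor), augmented by zeros for the vertices
that do not belong to that simplex. -/
structure IsWeightMatrix (d : ℕ) {r n : ℕ} (W : Matrix (Fin r) (Fin n) ℕ) : Prop where
  dim : n = r + d
  gcd_row : ∀ i, Finset.univ.gcd (W i) = 1
  column : ∀ j, ∃ i, W i j ≠ 0
  indep : LinearIndependent ℚ (fun (i : Fin r) (j : Fin n) => (W i j : ℚ))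
  vertices : ∃ (P : Set (Fin d → ℝ)) (v : Fin n → Fin d → ℤ),
    IsMinimalIPPolytope P ∧ Function.Injective v ∧
    Set.range (fun j => toReal (v j)) = P.extremePoints ℝ ∧
    ∀ i, ∑ j, W i j • v j = 0 ∧
      AffineIndependent ℝ (fun j : {j : Fin n // W i j ≠ 0} => toReal (v j))

/-- The Newton polytope `Δ(W)` of a generic polynomial of multidegree `Dᵢ = ∑ⱼ Wᵢⱼ`: the convex
hull of the exponent vectors `m` with `∑ⱼ Wᵢⱼ mⱼ = Dᵢ` for all `i`. -/
def newtonPolytope {r n : ℕ} (W : Matrix (Fin r) (Fin n) ℕ) : Set (Fin n → ℝ) :=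
  convexHull ℝ ((fun (m : Fin n → ℕ) (j : Fin n) => (m j : ℝ)) ''
    {m | ∀ i, ∑ j, W i j * m j = ∑ j, W i j})

/-- The affine space `∑ⱼ Wᵢⱼ xⱼ = Dᵢ` that carries the Newton polytope. -/
def newtonSpace {r n : ℕ} (W : Matrix (Fin r) (Fin n) ℕ) : Set (Fin n → ℝ) :=
  {x | ∀ i, ∑ j, (W i j : ℝ) * x j = ∑ j, (W i j : ℝ)}

/-- The lattice of integer vectors `γ` with `W γ = 0`.  The natural lattice of the Newton polytope,
`ℤⁿ ∩ newtonSpace W`, is this lattice with its origin put at `(1, …, 1)`; see `shift`. -/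
def newtonLattice {r n : ℕ} (W : Matrix (Fin r) (Fin n) ℕ) : AddSubgroup (Fin n → ℤ) where
  carrier := {γ | ∀ i, ∑ j, (W i j : ℤ) * γ j = 0}
  zero_mem' := by simp
  add_mem' := by
    intro a b ha hb i
    have h1 := ha i
    have h2 := hb i
    simp only [Pi.add_apply, mul_add, Finset.sum_add_distrib]
    rw [h1, h2, add_zero]
  neg_mem' := by
    intro a ha i
    have h1 := ha i
    simp only [Pi.neg_apply, mul_neg, Finset.sum_neg_distrib]
    rw [h1, neg_zero]

/-- The points `(1, …, 1) + γ`, `γ ∈ Γ`, of a lattice `Γ` with origin put at `(1, …, 1)`. -/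
def shift {n : ℕ} (Γ : AddSubgroup (Fin n → ℤ)) : Set (Fin n → ℝ) :=
  (fun γ => 1 + toReal γ) '' (Γ : Set (Fin n → ℤ))

/-- The interior of `P` relative to the ambient set `A`. -/
def interiorIn {n : ℕ} (A P : Set (Fin n → ℝ)) : Set (Fin n → ℝ) :=
  {x | x ∈ A ∧ P ∈ 𝓝[A] x}

/-- `P` is an IP polytope for the affine lattice `L` in the affine space `A`: a lattice polytope
with exactly one lattice point in its interior relative to `A`. -/
def IsIPPolytopeIn {n : ℕ} (A L P : Set (Fin n → ℝ)) : Prop :=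
  P ⊆ A ∧ IsLatticePolytope L P ∧ ∃! x, x ∈ L ∧ x ∈ interiorIn A P

/-- An IP weight matrix: a weight matrix whose Newton polytope is an IP polytope. -/
def IsIPWeightMatrix (d : ℕ) {r n : ℕ} (W : Matrix (Fin r) (Fin n) ℕ) : Prop :=
  IsWeightMatrix d W ∧
    IsIPPolytopeIn (newtonSpace W) (shift (newtonLattice W)) (newtonPolytope W)

/-- `P`, with the lattice `ℤᵈ`, is identified with `Q`, with the lattice `shift Γ`, by an injective
affine map that carries lattice onto lattice and origin to origin. -/
def LatticeEquivalent {d n : ℕ} (P : Set (Fin d → ℝ)) (Γ : AddSubgroup (Fin n → ℤ))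
    (Q : Set (Fin n → ℝ)) : Prop :=
  ∃ φ : (Fin d → ℝ) →ᵃ[ℝ] (Fin n → ℝ), Function.Injective φ ∧ φ 0 = 1 ∧
    φ '' latticePoints d = shift Γ ∧ φ '' P = Q

end IPC

/-! The generalized dual `ipDual` reverses inclusions, and every lattice polytope lies in its double
dual, so the dual of an IP-confined polytope is IPC-closed. A closed `M` containing `P` is recovered
from the lattice points of its polar. These form a subset of the finite set of lattice points of the
polar of `P`, so only finitely many closed `M` contain `P` and one of them is maximal. For reflexive
`P` the dual is the whole polar, which is a neighbourhood of the origin because `P` is bounded.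

For maximal `M`, choose a minimal set of lattice points of the polar whose hull `P` has the origin
in its interior. Then `P ⊆ ipDual M` gives `M ⊆ ipDual P`, and maximality makes this an equality
(`exists_minimal_convexHull_ipDual_eq`). Steinitz's theorem bounds the number `n` of vertices `v j`
by `2 * d`.

The linear relations among the `v j` form a space of dimension `n - d` spanned by relations of
simplices (`mem_span_circuits`); a basis of these gives the rows of `W`, so the rank is at most `d`.
The map `y ↦ (1 + v j ⬝ y)ⱼ` turns the inequalities of the polar into nonnegativity of coordinates,
and hence carries `M` to the hull of the points of `Δ(W)` in the image lattice
(`distanceMap_image_ipDual`). -/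

namespace IPC

/-! ### Generalized duality, closure and maximal closed polytopes -/

section Duality

variable {d : ℕ} {P Q : Set (Fin d → ℝ)}

theorem exists_pos_add_smul_mem {E : Type*} [AddCommGroup E] [Module ℝ E] [TopologicalSpace E]
    [ContinuousAdd E] [ContinuousSMul ℝ E] {s : Set E} {x : E} (hx : s ∈ 𝓝 x) (v : E) :
    ∃ ε : ℝ, 0 < ε ∧ x + ε • v ∈ s := by
  have hc : Filter.Tendsto (fun t : ℝ => x + t • v) (𝓝[>] 0) (𝓝 x) := by
    have : Continuous (fun t : ℝ => x + t • v) := by fun_prop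
    have h := this.tendsto 0
    simp only [zero_smul, add_zero] at h
    exact h.mono_left nhdsWithin_le_nhds
  obtain ⟨ε, h1, h2⟩ := ((hc.eventually hx).and self_mem_nhdsWithin).exists
  exact ⟨ε, h2, h1⟩

theorem polar_anti (h : P ⊆ Q) : polar Q ⊆ polar P := fun _ hy x hx => hy x (h hx)

theorem ipDual_anti (h : P ⊆ Q) : ipDual Q ⊆ ipDual P :=
  convexHull_mono (Set.inter_subset_inter_left _ (polar_anti h))

theorem convex_setOf_le_dotProduct (y : Fin d → ℝ) (c : ℝ) : Convex ℝ {x | c ≤ y ⬝ᵥ x} :=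
  convex_halfSpace_ge ⟨fun a b => dotProduct_add y a b, fun a b => dotProduct_smul a y b⟩ c

theorem convex_polar (P : Set (Fin d → ℝ)) : Convex ℝ (polar P) := by
  have : polar P = ⋂ x ∈ P, {y | -1 ≤ x ⬝ᵥ y} := by
    ext y; simp [polar, dotProduct_comm]
  rw [this]
  exact convex_iInter₂ fun x _ => convex_setOf_le_dotProduct x (-1)

theorem polar_convexHull (s : Set (Fin d → ℝ)) : polar (convexHull ℝ s) = polar s := by
  refine Set.Subset.antisymm (polar_anti (subset_convexHull ℝ s)) fun y hy x hx => ?_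
  exact convexHull_min (t := {x | -1 ≤ y ⬝ᵥ x}) hy (convex_setOf_le_dotProduct y (-1)) hx

theorem ipDual_subset_polar (P : Set (Fin d → ℝ)) : ipDual P ⊆ polar P :=
  convexHull_min Set.inter_subset_left (convex_polar P)

theorem isBounded_polar (h : 0 ∈ interior P) : Bornology.IsBounded (polar P) := by
  obtain ⟨ε, hε, hb⟩ := Metric.mem_nhds_iff.1 (mem_interior_iff_mem_nhds.1 h)
  have hmem : ∀ i, ∀ c : ℝ, |c| < ε → Pi.single i c ∈ P := fun i c hc => hb <| by
    rw [mem_ball_zero_iff, pi_norm_lt_iff hε]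
    intro j
    by_cases hj : j = i
    · subst hj; simpa using hc
    · simpa [hj] using hε
  refine (Metric.isBounded_closedBall (x := (0 : Fin d → ℝ)) (r := 2 / ε)).subset fun y hy => ?_
  rw [mem_closedBall_zero_iff, pi_norm_le_iff_of_nonneg (by positivity)]
  intro i
  have h1 := hy _ (hmem i (ε / 2) (by rw [abs_of_pos] <;> linarith))
  have h2 := hy _ (hmem i (-(ε / 2)) (by rw [abs_neg, abs_of_pos] <;> linarith))
  simp only [dotProduct_single] at h1 h2
  rw [Real.norm_eq_abs, abs_le, ← neg_div, div_le_iff₀ hε, le_div_iff₀ hε]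
  constructor <;> linarith

theorem finite_inter_latticePoints (h : Bornology.IsBounded P) : (P ∩ latticePoints d).Finite := by
  obtain ⟨R, hR⟩ := h.exists_norm_le
  refine ((Set.finite_Icc (fun _ : Fin d => -⌈R⌉) (fun _ => ⌈R⌉)).image toReal).subset ?_
  rintro _ ⟨hx, z, rfl⟩
  refine ⟨z, ?_, rfl⟩
  have hz : ∀ i, |(z i : ℝ)| ≤ ⌈R⌉ := fun i =>
    ((norm_le_pi_norm (toReal z) i).trans (hR _ hx)).trans (Int.le_ceil R)
  constructor <;> intro i <;> have := abs_le.1 (hz i)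
  · exact_mod_cast this.1
  · exact_mod_cast this.2

theorem finite_polar_inter (h : 0 ∈ interior P) : (polar P ∩ latticePoints d).Finite :=
  finite_inter_latticePoints (isBounded_polar h)

theorem isLatticePolytope_ipDual (h : 0 ∈ interior P) :
    IsLatticePolytope (latticePoints d) (ipDual P) :=
  ⟨(finite_polar_inter h).toFinset, by simp, by simp [ipDual]⟩

theorem IsLatticePolytope.convex {n : ℕ} {L P : Set (Fin n → ℝ)} (hP : IsLatticePolytope L P) :
    Convex ℝ P := by
  obtain ⟨s, -, rfl⟩ := hP
  exact convex_convexHull ℝ _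

theorem IsLatticePolytope.isCompact {n : ℕ} {L P : Set (Fin n → ℝ)} (hP : IsLatticePolytope L P) :
    IsCompact P := by
  obtain ⟨s, -, rfl⟩ := hP
  exact s.finite_toSet.isCompact_convexHull (𝕜 := ℝ)

theorem IsLatticePolytope.convexHull_inter {n : ℕ} {L P : Set (Fin n → ℝ)}
    (hP : IsLatticePolytope L P) : convexHull ℝ (P ∩ L) = P := by
  refine Set.Subset.antisymm (convexHull_min Set.inter_subset_left hP.convex) ?_
  obtain ⟨s, hs, rfl⟩ := hP
  exact convexHull_mono (Set.subset_inter (subset_convexHull ℝ _) hs)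

theorem subset_polar_polar (P : Set (Fin d → ℝ)) : P ⊆ polar (polar P) := fun x hx y hy => by
  rw [dotProduct_comm]; exact hy x hx

theorem subset_ipDual_of_subset_polar (hP : IsLatticePolytope (latticePoints d) P)
    (h : Q ⊆ polar P) : P ⊆ ipDual Q := by
  rw [← hP.convexHull_inter]
  exact convexHull_mono
    (Set.inter_subset_inter_left _ ((subset_polar_polar P).trans (polar_anti h)))

theorem subset_ipDual_ipDual (hP : IsLatticePolytope (latticePoints d) P) :
    P ⊆ ipDual (ipDual P) :=
  subset_ipDual_of_subset_polar hP (ipDual_subset_polar P)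

theorem IsIPPolytope.zero_mem_interior (hP : IsIPPolytope P) : 0 ∈ interior P :=
  (hP.2.symm.subset rfl : (0 : Fin d → ℝ) ∈ interior P ∩ latticePoints d).1

theorem zero_mem_latticePoints : (0 : Fin d → ℝ) ∈ latticePoints d := ⟨0, by ext; simp [toReal]⟩

theorem toReal_dotProduct (a b : Fin d → ℤ) :
    toReal a ⬝ᵥ toReal b = ((a ⬝ᵥ b : ℤ) : ℝ) := by
  simp [toReal, dotProduct]

theorem eq_zero_of_forall_dotProduct_nonneg (hP : 0 ∈ interior P) {y : Fin d → ℝ}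
    (h : ∀ x ∈ P, 0 ≤ y ⬝ᵥ x) : y = 0 := by
  obtain ⟨ε, hε, hm⟩ := exists_pos_add_smul_mem (mem_interior_iff_mem_nhds.1 hP) (-y)
  have h1 := h _ hm
  simp only [zero_add, dotProduct_smul, dotProduct_neg, smul_eq_mul] at h1
  have h2 : y ⬝ᵥ y ≤ 0 := by
    by_contra! hc
    nlinarith [mul_pos hε hc]
  refine dotProduct_self_eq_zero.1 (le_antisymm h2 ?_)
  exact Finset.sum_nonneg fun i _ => mul_self_nonneg _

/-- If `y` is interior, some `(1 + ε) y` is still in the polar, so the integers `y ⬝ x` exceed `-1`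
and are nonnegative. A functional that is nonnegative on a neighbourhood of the origin vanishes. -/
theorem interior_polar_inter_latticePoints (hP : IsLatticePolytope (latticePoints d) P)
    (h0 : 0 ∈ interior P) : interior (polar P) ∩ latticePoints d ⊆ {0} := by
  rintro _ ⟨hy, y, rfl⟩
  refine eq_zero_of_forall_dotProduct_nonneg h0 fun x hx => ?_
  rw [← hP.convexHull_inter] at hx
  refine convexHull_min (t := {x | 0 ≤ toReal y ⬝ᵥ x}) ?_ (convex_setOf_le_dotProduct _ 0) hx
  rintro _ ⟨hx, x, rfl⟩
  obtain ⟨ε, hε, hm⟩ := exists_pos_add_smul_mem (mem_interior_iff_mem_nhds.1 hy) (toReal y)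
  have h1 := hm _ hx
  simp only [add_dotProduct, smul_dotProduct, smul_eq_mul, toReal_dotProduct] at h1
  simp only [Set.mem_ofPred_eq, toReal_dotProduct]
  by_contra! hc
  have h2 : ((y ⬝ᵥ x : ℤ) : ℝ) ≤ -1 := by
    have : y ⬝ᵥ x ≤ -1 := by have : y ⬝ᵥ x < 0 := by exact_mod_cast hc
                             omega
    exact_mod_cast this
  nlinarith

theorem IsIPPolytope.ipDual (hP : IsIPPolytope P) (h : 0 ∈ interior (ipDual P)) :
    IsIPPolytope (ipDual P) := by
  refine ⟨isLatticePolytope_ipDual hP.zero_mem_interior, Set.Subset.antisymm ?_ ?_⟩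
  · exact (Set.inter_subset_inter_left _ (interior_mono (ipDual_subset_polar P))).trans
      (interior_polar_inter_latticePoints hP.1 hP.zero_mem_interior)
  · rintro _ rfl
    exact ⟨h, zero_mem_latticePoints⟩

theorem IsIPConfined.isIPCClosed_ipDual (hP : IsIPConfined P) : IsIPCClosed (ipDual P) := by
  have h := subset_ipDual_ipDual hP.1.1
  refine ⟨⟨hP.1.ipDual hP.2.2, isLatticePolytope_ipDual hP.2.2,
    interior_mono h hP.1.zero_mem_interior⟩, ?_⟩
  exact Set.Subset.antisymm (subset_ipDual_ipDual hP.2.1) (ipDual_anti h)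

theorem IsIPConfined.exists_maximal (hP : IsIPConfined P) :
    ∃ M : Set (Fin d → ℝ), Maximal IsIPCClosed M ∧ P ⊆ M := by
  -- A closed `M` is determined by the lattice points of its polar, a subset of those of the polar
  -- of `P`.
  have hfin : {M | IsIPCClosed M ∧ P ⊆ M}.Finite := by
    have hQ := (finite_polar_inter hP.1.zero_mem_interior).finite_subsets
    refine (hQ.image fun s => IPC.ipDual (convexHull ℝ s)).subset ?_
    rintro M ⟨hM, hPM⟩
    exact ⟨polar M ∩ latticePoints d, Set.inter_subset_inter_left _ (polar_anti hPM), hM.2.symm⟩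
  obtain ⟨M, hM1, hM2⟩ := hfin.exists_le_maximal
    (a := IPC.ipDual (IPC.ipDual P))
    ⟨hP.isIPCClosed_ipDual.1.isIPCClosed_ipDual, subset_ipDual_ipDual hP.1.1⟩
  exact ⟨M, ⟨hM2.1.1, fun N hN hMN => hM2.2 ⟨hN, hM2.1.2.trans hMN⟩ hMN⟩, hM2.1.2⟩

theorem zero_mem_interior_polar (hP : Bornology.IsBounded P) : 0 ∈ interior (polar P) := by
  obtain ⟨R, hR, hb⟩ := hP.exists_pos_norm_le
  rw [mem_interior_iff_mem_nhds]
  have hc : 0 < 1 / (d * R + 1) := by positivity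
  refine Filter.mem_of_superset (Metric.ball_mem_nhds 0 hc) fun y hy x hx => ?_
  rw [mem_ball_zero_iff] at hy
  refine (abs_le.1 ?_).1
  calc |y ⬝ᵥ x| ≤ ∑ i, |y i * x i| := Finset.abs_sum_le_sum_abs _ _
    _ ≤ ∑ i : Fin d, 1 / (d * R + 1) * R := by
        refine Finset.sum_le_sum fun i _ => ?_
        rw [abs_mul]
        exact mul_le_mul ((norm_le_pi_norm y i).trans hy.le) ((norm_le_pi_norm x i).trans (hb x hx))
          (abs_nonneg _) hc.le
    _ = (d * R) / (d * R + 1) := by simp; ring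
    _ ≤ 1 := by rw [div_le_one (by positivity)]; linarith

theorem IsReflexive.isIPConfined (hP : IsReflexive P) : IsIPConfined P := by
  have h : IPC.ipDual P = polar P := hP.2.convexHull_inter
  rw [IsIPConfined, h]
  exact ⟨hP.1, hP.2, zero_mem_interior_polar hP.1.1.isCompact.isBounded⟩

end Duality

/-! ### Nonnegative linear combinations -/

section PositiveRelations

variable {ι E : Type*} [AddCommGroup E] [Module ℝ E]

/-- The ratio test of the simplex method: `t` is the least `c i / g i` over the `i` with `g i > 0`.
-/
theorem exists_nonneg_sub_mul {s : Finset ι} {c g : ι → ℝ} (hc : ∀ i ∈ s, 0 ≤ c i)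
    (hg : ∃ i ∈ s, 0 < g i) :
    ∃ t : ℝ, (∀ i ∈ s, 0 ≤ c i - t * g i) ∧ ∃ j ∈ s, c j - t * g j = 0 := by
  obtain ⟨i, hi, hgi⟩ := hg
  obtain ⟨j, hj, hmin⟩ := (s.filter fun i => 0 < g i).exists_min_image (fun i => c i / g i)
    ⟨i, by simp [hi, hgi]⟩
  simp only [Finset.mem_filter] at hj hmin
  refine ⟨c j / g j, fun k hk => ?_, j, hj.1, by rw [div_mul_cancel₀ _ hj.2.ne']; simp⟩
  by_cases h : 0 < g k
  · have := (le_div_iff₀ h).1 (hmin k ⟨hk, h⟩)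
    linarith
  · have h1 : 0 ≤ c j / g j := div_nonneg (hc j hj.1) hj.2.le
    nlinarith [hc k hk]

/-- Carathéodory's theorem for convex cones. -/
theorem exists_linearIndepOn_nonneg_sum_eq [DecidableEq E] (s : Finset E) (c : E → ℝ)
    (hc : ∀ x ∈ s, 0 ≤ c x) :
    ∃ t ⊆ s, ∃ c' : E → ℝ, (∀ x ∈ t, 0 ≤ c' x) ∧ ∑ x ∈ t, c' x • x = ∑ x ∈ s, c x • x ∧
      LinearIndepOn ℝ id (t : Set E) := by
  induction s using Finset.strongInduction generalizing c with
  | H s ih =>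
    by_cases hs : LinearIndepOn ℝ id (s : Set E)
    · exact ⟨s, subset_rfl, c, hc, rfl, hs⟩
    obtain ⟨g, hg, hpos⟩ : ∃ g : E → ℝ, ∑ x ∈ s, g x • x = 0 ∧ ∃ x ∈ s, 0 < g x := by
      simp only [linearIndepOn_finset_iff, id, not_forall] at hs
      obtain ⟨g, hg, x, hx, hne⟩ := hs
      rcases lt_or_gt_of_ne hne with h | h
      · exact ⟨-g, by simp [hg], x, hx, by simpa using h⟩
      · exact ⟨g, hg, x, hx, h⟩
    obtain ⟨t, ht, j, hj, hj0⟩ := exists_nonneg_sub_mul hc hpos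
    obtain ⟨u, hu, c', h1, h2, h3⟩ := ih (s.erase j) (Finset.erase_ssubset hj)
      (fun x => c x - t * g x) fun x hx => ht x (Finset.mem_of_mem_erase hx)
    refine ⟨u, hu.trans (Finset.erase_subset _ _), c', h1, ?_, h3⟩
    rw [h2, Finset.sum_erase _ (by simp [hj0])]
    simp [sub_smul, mul_smul, Finset.sum_sub_distrib, ← Finset.smul_sum, hg]

end PositiveRelations

/-! ### Interior points of convex hulls and Steinitz's theorem -/

section Interior

variable {E : Type*} [NormedAddCommGroup E] [NormedSpace ℝ E]

theorem span_eq_top_of_zero_mem_interior_convexHull {s : Set E}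
    (h : 0 ∈ interior (convexHull ℝ s)) : Submodule.span ℝ s = ⊤ := by
  refine Submodule.eq_top_of_nonempty_interior' _ ⟨0, interior_mono ?_ h⟩
  exact convexHull_min Submodule.subset_span (Submodule.span ℝ s).convex

theorem exists_pos_relation_of_zero_mem_interior_convexHull {s : Finset E}
    (h : 0 ∈ interior (convexHull ℝ (s : Set E))) :
    ∃ p : E → ℝ, (∀ x ∈ s, 0 < p x) ∧ ∑ x ∈ s, p x • x = 0 := by
  -- Write `-ε ∑ x` as a convex combination; adding `ε` to every coefficient gives a strictly
  -- positive relation.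
  obtain ⟨ε, hε, hm⟩ :=
    exists_pos_add_smul_mem (mem_interior_iff_mem_nhds.1 h) (-∑ x ∈ s, x)
  obtain ⟨w, hw, -, hsum⟩ := Finset.mem_convexHull'.1 hm
  refine ⟨fun x => w x + ε, fun x hx => add_pos_of_nonneg_of_pos (hw x hx) hε, ?_⟩
  simp [add_smul, Finset.sum_add_distrib, hsum, Finset.smul_sum]

/-- Positive coefficient vectors of sum less than one form an open set, whose image under the open
map `T` is open. Adding a multiple of the relation `p` raises the sum to one without moving the
point, so this image lies in the hull. -/
theorem zero_mem_interior_convexHull [FiniteDimensional ℝ E] {s : Finset E} (hs : s.Nonempty)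
    (hspan : Submodule.span ℝ (s : Set E) = ⊤) {p : E → ℝ} (hp : ∀ x ∈ s, 0 < p x)
    (hp0 : ∑ x ∈ s, p x • x = 0) : 0 ∈ interior (convexHull ℝ (s : Set E)) := by
  let T : (s → ℝ) →ₗ[ℝ] E := Fintype.linearCombination ℝ (fun x : s => (x : E))
  have hT : ∀ c, T c = ∑ x : s, c x • (x : E) := fun c => Fintype.linearCombination_apply ..
  have hsurj : Function.Surjective T := by
    rw [← LinearMap.range_eq_top, Fintype.range_linearCombination]
    simpa using hspan
  have hsum : 0 < ∑ x : s, p x := by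
    have : Nonempty s := hs.to_subtype
    exact Finset.sum_pos (fun x _ => hp x x.2) Finset.univ_nonempty
  have hp1 : ∑ x : s, p x • (x : E) = 0 := by
    rw [← hp0, ← Finset.sum_coe_sort s]
  let U : Set (s → ℝ) := {c | (∀ x, 0 < c x) ∧ ∑ x, c x < 1}
  have hU : IsOpen U := by
    have : U = (⋂ x, {c | 0 < c x}) ∩ {c | ∑ x, c x < 1} := by ext; simp [U]
    rw [this]
    exact (isOpen_iInter_of_finite fun x => isOpen_lt continuous_const (continuous_apply x)).inter
      (isOpen_lt (continuous_finsetSum _ fun x _ => continuous_apply x) continuous_const)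
  refine mem_interior.2 ⟨T '' U, ?_, T.isOpenMap_of_finiteDimensional hsurj U hU, ?_⟩
  · rintro _ ⟨c, ⟨hc, hc1⟩, rfl⟩
    have h0 : 0 < (1 - ∑ x, c x) / ∑ x : s, p x := div_pos (by linarith) hsum
    set t := (1 - ∑ x, c x) / ∑ x : s, p x with ht
    have : T c = ∑ x : s, (c x + t * p x) • (x : E) := by
      simp only [hT, add_smul, mul_smul, Finset.sum_add_distrib, ← Finset.smul_sum, hp1, smul_zero,
        add_zero]
    rw [this]
    refine (convex_convexHull ℝ _).sum_mem (fun x _ => ?_) ?_ fun x _ =>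
      subset_convexHull ℝ _ x.2
    · exact add_nonneg (hc x).le (mul_nonneg h0.le (hp x x.2).le)
    · rw [Finset.sum_add_distrib, ← Finset.mul_sum, ht, div_mul_cancel₀ _ hsum.ne']
      ring
  · refine ⟨fun x => (2 * ∑ x : s, p x)⁻¹ * p x, ⟨fun x => ?_, ?_⟩, ?_⟩
    · exact mul_pos (by positivity) (hp x x.2)
    · rw [← Finset.mul_sum, inv_mul_lt_one₀ (by positivity)]
      linarith
    · simp only [hT, mul_smul, ← Finset.smul_sum, hp1, smul_zero]

/-- Steinitz's theorem: a point in the interior of the convex hull of `s` lies in the interior of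
the convex hull of at most `2 * dim E` points of `s`. -/
theorem exists_subset_card_le_zero_mem_interior_convexHull [FiniteDimensional ℝ E] [Nontrivial E]
    {s : Finset E} (h : 0 ∈ interior (convexHull ℝ (s : Set E))) :
    ∃ t ⊆ s, t.card ≤ 2 * Module.finrank ℝ E ∧ 0 ∈ interior (convexHull ℝ (t : Set E)) := by
  classical
  obtain ⟨p, hp, hp0⟩ := exists_pos_relation_of_zero_mem_interior_convexHull h
  obtain ⟨b, hbs, hcard, hspan, hb⟩ :=
    Submodule.exists_finset_span_eq_linearIndepOn ℝ (s : Set E)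
  rw [span_eq_top_of_zero_mem_interior_convexHull h, finrank_top] at hcard
  rw [span_eq_top_of_zero_mem_interior_convexHull h] at hspan
  rw [Finset.coe_subset] at hbs
  have hbne : b.Nonempty := by
    rw [← Finset.card_pos, hcard]
    exact Module.finrank_pos
  obtain ⟨m, hm, hmin⟩ := b.exists_min_image p hbne
  have hpm := hp m (hbs hm)
  -- Lowering the relation `p` by its minimum over the basis `b` leaves a nonnegative combination
  -- equal to `-p m • ∑ b`. Carathéodory rewrites it on an independent set, so `b` and that set
  -- together carry a positive relation on at most `2 * dim E` points.
  obtain ⟨t, hts, c, hc, hsum, ht⟩ := exists_linearIndepOn_nonneg_sum_eq s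
    (fun x => p x - if x ∈ b then p m else 0) (fun x hx => by
      split_ifs with hxb
      · exact sub_nonneg.2 (hmin x hxb)
      · simpa using (hp x hx).le)
  have hinter : s ∩ b = b := Finset.inter_eq_right.2 hbs
  have hsum' : ∑ x ∈ t, c x • x = -∑ x ∈ b, p m • x := by
    rw [hsum]
    simp [sub_smul, Finset.sum_sub_distrib, hp0, ite_smul, Finset.sum_ite_mem, hinter]
  let q : E → ℝ := fun x => (if x ∈ t then c x else 0) + if x ∈ b then p m else 0
  let u := b ∪ t.filter fun x => 0 < c x
  have hq : ∀ x ∈ u, 0 < q x := by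
    intro x hx
    have h1 : 0 ≤ if x ∈ t then c x else 0 := by
      split_ifs with hxt
      exacts [hc x hxt, le_rfl]
    have h2 : 0 ≤ if x ∈ b then p m else 0 := by split_ifs <;> linarith
    rcases Finset.mem_union.1 hx with hx | hx
    · exact add_pos_of_nonneg_of_pos h1 (by simpa [hx] using hpm)
    · rw [Finset.mem_filter] at hx
      exact add_pos_of_pos_of_nonneg (by simpa [hx.1] using hx.2) h2
  refine ⟨u, Finset.union_subset hbs ((Finset.filter_subset _ _).trans hts), ?_, ?_⟩
  · have h1 : (t.filter fun x => 0 < c x).card ≤ Module.finrank ℝ E := by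
      refine (Finset.card_filter_le _ _).trans ?_
      simpa using ht.linearIndependent.fintype_card_le_finrank
    have h2 := Finset.card_union_le b (t.filter fun x => 0 < c x)
    change (b ∪ t.filter fun x => 0 < c x).card ≤ _
    omega
  · refine zero_mem_interior_convexHull (hbne.mono Finset.subset_union_left) ?_ hq ?_
    · exact top_unique (hspan ▸ Submodule.span_mono (by simp [u]))
    · have h1 : ∑ x ∈ u, (if x ∈ t then c x else 0) • x = ∑ x ∈ t, c x • x := by
        simp only [ite_smul, zero_smul, Finset.sum_ite_mem]
        refine Finset.sum_subset Finset.inter_subset_right fun x hx hxu => ?_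
        have : ¬ 0 < c x := fun h => hxu (by simp [u, hx, h])
        simp [le_antisymm (not_lt.1 this) (hc x hx)]
      have h2 : ∑ x ∈ u, (if x ∈ b then p m else 0) • x = ∑ x ∈ b, p m • x := by
        simp only [ite_smul, zero_smul, Finset.sum_ite_mem]
        rw [Finset.inter_eq_right.2 Finset.subset_union_left]
      simp only [q, add_smul, Finset.sum_add_distrib]
      rw [h1, h2, hsum', neg_add_cancel]

end Interior

/-! ### Nonnegative relations are spanned by those of simplices -/

section Circuits

variable {d n : ℕ}

/-- The weight vectors of simplices with vertices among the `v j`, as real vectors. -/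
def circuits (v : Fin n → Fin d → ℤ) : Set (Fin n → ℝ) :=
  {w | ∃ g : Fin n → ℕ, w = (fun j => (g j : ℝ)) ∧ Finset.univ.gcd g = 1 ∧ ∑ j, g j • v j = 0 ∧
    AffineIndependent ℝ (fun j : {j : Fin n // g j ≠ 0} => toReal (v j))}

theorem sum_smul_toReal_apply (v : Fin n → Fin d → ℤ) (w : Fin n → ℝ) (k : Fin d) :
    (∑ j, w j • toReal (v j)) k = ∑ j, w j * (v j k : ℝ) := by
  simp [toReal, Finset.sum_apply]

/-- A real relation between integer vectors is nonzero at `j` only if some rational relation with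
no larger support is equal to one at `j`. -/
theorem exists_rat_relation (v : Fin n → Fin d → ℤ) {w : Fin n → ℝ}
    (hw : ∑ j, w j • toReal (v j) = 0) {i : Fin n} (hi : w i ≠ 0) :
    ∃ g : Fin n → ℚ, g i = 1 ∧ (∀ j, w j = 0 → g j = 0) ∧ ∀ k, ∑ j, g j * (v j k : ℚ) = 0 := by
  -- A `ℚ`-linear functional on `ℝ`, applied to the coefficients, preserves relations between
  -- integer vectors.
  obtain ⟨f, hf⟩ := Module.exists_dual_forall_apply_eq_one (K := ℚ) (v := w) (s := {i})
    (LinearIndepOn.singleton hi)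
  refine ⟨fun j => f (w j), hf i rfl, fun j hj => by simp [hj], fun k => ?_⟩
  have h := congrArg f (congrFun hw k)
  rw [sum_smul_toReal_apply, map_sum, Pi.zero_apply, map_zero] at h
  rw [← h]
  refine Finset.sum_congr rfl fun j _ => ?_
  have : w j * (v j k : ℝ) = (v j k : ℚ) • w j := by
    rw [Rat.smul_def]; push_cast; ring
  rw [this, map_smul, smul_eq_mul, mul_comm]

theorem exists_nat_smul_eq {g : Fin n → ℚ} (hg : ∀ j, 0 ≤ g j) (h0 : ∃ j, g j ≠ 0) :
    ∃ (G : Fin n → ℕ) (c : ℚ), 0 < c ∧ (∀ j, (G j : ℚ) = c * g j) ∧ Finset.univ.gcd G = 1 := by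
  obtain ⟨i, hi⟩ := h0
  set D : ℕ := ∏ j, (g j).den with hD
  have hDpos : 0 < D := Finset.prod_pos fun j _ => (g j).den_pos
  have hint : ∀ j, ∃ m : ℕ, (m : ℚ) = D * g j := fun j => by
    obtain ⟨e, he⟩ : (g j).den ∣ D := Finset.dvd_prod_of_mem _ (Finset.mem_univ j)
    refine ⟨e * (g j).num.toNat, ?_⟩
    have h1 : (((g j).num.toNat : ℤ) : ℚ) = (g j).num := by
      rw [Int.toNat_of_nonneg (Rat.num_nonneg.2 (hg j))]
    rw [Int.cast_natCast] at h1
    rw [he]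
    push_cast
    rw [h1, ← Rat.mul_den_eq_num (g j)]
    ring
  choose m hm using hint
  obtain ⟨G, hG, hG1⟩ := Finset.univ.extract_gcd m ⟨i, Finset.mem_univ i⟩
  have hmi : m i ≠ 0 := fun h => by
    have := hm i
    rw [h] at this
    simp [hi, hDpos.ne'] at this
  have hgcd : 0 < Finset.univ.gcd m :=
    Nat.pos_of_ne_zero fun h => hmi (Finset.gcd_eq_zero_iff.1 h i (Finset.mem_univ i))
  refine ⟨G, D / (Finset.univ.gcd m : ℕ), by positivity, fun j => ?_, hG1⟩
  have := hG j (Finset.mem_univ j)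
  rw [div_mul_eq_mul_div, ← hm, eq_div_iff (by positivity), this]
  push_cast
  ring

/-- Uniqueness up to scale makes `w` proportional to a rational relation, hence to a primitive
integral one. An affine dependence on the support would be a multiple of `w` with coefficient sum
zero, while the sum of `w` is positive. -/
theorem exists_circuit_of_forall_relation_eq_smul (v : Fin n → Fin d → ℤ) {w : Fin n → ℝ}
    (hw0 : ∀ j, 0 ≤ w j) (hw : ∑ j, w j • toReal (v j) = 0) {i : Fin n} (hi : w i ≠ 0)
    (hrel : ∀ h : Fin n → ℝ, (∀ j, w j = 0 → h j = 0) → ∑ j, h j • toReal (v j) = 0 →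
      ∃ a : ℝ, h = a • w) :
    ∃ c ∈ circuits v, ∃ a : ℝ, w = a • c := by
  obtain ⟨g, hgi, hgs, hg⟩ := exists_rat_relation v hw hi
  obtain ⟨a, ha⟩ := hrel (fun j => (g j : ℝ)) (fun j hj => by simp [hgs j hj]) (by
    ext k
    rw [sum_smul_toReal_apply, Pi.zero_apply]
    exact_mod_cast congrArg (Rat.cast : ℚ → ℝ) (hg k))
  have ha' : ∀ j, (g j : ℝ) = a * w j := fun j => congrFun ha j
  have hwi : 0 < w i := lt_of_le_of_ne (hw0 i) hi.symm
  have hapos : 0 < a := by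
    have h1 := ha' i
    rw [hgi, Rat.cast_one] at h1
    by_contra! hc
    nlinarith
  have hg0 : ∀ j, 0 ≤ g j := fun j => by
    have := mul_nonneg hapos.le (hw0 j)
    rw [← ha'] at this
    exact_mod_cast this
  obtain ⟨G, c, hc, hG, hG1⟩ := exists_nat_smul_eq hg0 ⟨i, by simp [hgi]⟩
  have hGw : ∀ j, (G j : ℝ) = c * a * w j := fun j => by
    rw [mul_assoc, ← ha']
    exact_mod_cast congrArg (Rat.cast : ℚ → ℝ) (hG j)
  have hca : (0 : ℝ) < c * a := mul_pos (by exact_mod_cast hc) hapos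
  refine ⟨fun j => G j, ⟨G, rfl, hG1, ?_, ?_⟩, (c * a)⁻¹, ?_⟩
  · ext k
    have h1 : ∑ j, (G j : ℚ) * (v j k : ℚ) = 0 := by
      simp only [hG, mul_assoc, ← Finset.mul_sum, hg k, mul_zero]
    have h2 : ((∑ j, (G j : ℤ) * v j k : ℤ) : ℚ) = 0 := by exact_mod_cast h1
    simpa [Finset.sum_apply] using (Int.cast_eq_zero.1 h2)
  · rw [affineIndependent_iff_of_fintype]
    intro u hu hu0 j
    rw [Finset.univ.weightedVSub_eq_linear_combination hu] at hu0
    set h : Fin n → ℝ := fun j => if hj : G j ≠ 0 then u ⟨j, hj⟩ else 0 with hh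
    have hval : ∀ j : {j // G j ≠ 0}, h j = u j := fun j => by simp [hh, j.2]
    have hout : ∀ j ∉ Set.range (Subtype.val : {j // G j ≠ 0} → Fin n), h j = 0 := fun j hj => by
      have : G j = 0 := by simpa using hj
      simp [hh, this]
    obtain ⟨b, hb⟩ := hrel h
      (fun j hj => by
        have h1 := hGw j
        rw [hj, mul_zero, Nat.cast_eq_zero] at h1
        simp [hh, h1])
      (by
        rw [← hu0]
        exact (Fintype.sum_of_injective _ Subtype.val_injective _ _
          (fun j hj => by rw [hout j hj, zero_smul]) (fun j => by rw [hval])).symm)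
    have hsum : ∑ j, h j = 0 := by
      rw [← hu]
      exact (Fintype.sum_of_injective _ Subtype.val_injective _ _ hout
        (fun j => (hval j).symm)).symm
    have hwsum : 0 < ∑ j, w j := Finset.sum_pos' (fun j _ => hw0 j) ⟨i, Finset.mem_univ i, hwi⟩
    have hb0 : b = 0 := by
      rw [hb] at hsum
      simp only [Pi.smul_apply, smul_eq_mul, ← Finset.mul_sum] at hsum
      exact (mul_eq_zero.1 hsum).resolve_right hwsum.ne'
    rw [← hval, hb, hb0, zero_smul, Pi.zero_apply]
  · ext j
    simp only [Pi.smul_apply, smul_eq_mul, hGw]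
    rw [inv_mul_cancel_left₀ hca.ne']

/-- Induction on the support. Either `w` is the only relation on its support up to scale, hence a
multiple of a circuit, or subtracting a multiple of another relation splits `w` into nonnegative
relations of smaller support. -/
theorem mem_span_circuits (v : Fin n → Fin d → ℤ) (s : Finset (Fin n)) (w : Fin n → ℝ)
    (hws : ∀ j ∉ s, w j = 0) (hw0 : ∀ j ∈ s, 0 ≤ w j) (hw : ∑ j, w j • toReal (v j) = 0) :
    w ∈ Submodule.span ℝ (circuits v) := by
  induction s using Finset.strongInduction generalizing w with
  | H s ih =>
    have step : ∀ w : Fin n → ℝ, (∀ j ∉ s, w j = 0) → (∀ j ∈ s, 0 ≤ w j) →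
        ∑ j, w j • toReal (v j) = 0 → (∃ j ∈ s, w j = 0) →
        w ∈ Submodule.span ℝ (circuits v) := by
      rintro w hws hw0 hw ⟨j, hj, hj0⟩
      refine ih (s.erase j) (Finset.erase_ssubset hj) w (fun k hk => ?_)
        (fun k hk => hw0 k (Finset.mem_of_mem_erase hk)) hw
      by_cases hkj : k = j
      · rw [hkj, hj0]
      · exact hws k fun h => hk (Finset.mem_erase.2 ⟨hkj, h⟩)
    have reduce : ∀ h : Fin n → ℝ, (∀ j ∉ s, h j = 0) → ∑ j, h j • toReal (v j) = 0 →
        (∃ j ∈ s, 0 < h j) → ∃ t : ℝ, w - t • h ∈ Submodule.span ℝ (circuits v) ∧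
          ∀ j, 0 ≤ (w - t • h) j := by
      intro h hhs hh hpos
      obtain ⟨t, ht, j, hj, hj0⟩ := exists_nonneg_sub_mul hw0 hpos
      have hoff : ∀ j ∉ s, (w - t • h) j = 0 := fun j hj => by simp [hws j hj, hhs j hj]
      refine ⟨t, step _ hoff ht ?_ ⟨j, hj, hj0⟩, fun j => ?_⟩
      · simp [sub_smul, mul_smul, Finset.sum_sub_distrib, ← Finset.smul_sum, hw, hh]
      · by_cases hjs : j ∈ s
        · exact ht j hjs
        · exact (hoff j hjs).ge
    by_cases hzero : ∃ j ∈ s, w j = 0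
    · exact step w hws hw0 hw hzero
    push Not at hzero
    rcases s.eq_empty_or_nonempty with rfl | ⟨i, hi⟩
    · have : w = 0 := by ext j; exact hws j (by simp)
      simp [this]
    by_cases hrel : ∀ h : Fin n → ℝ, (∀ j, w j = 0 → h j = 0) → ∑ j, h j • toReal (v j) = 0 →
      ∃ a : ℝ, h = a • w
    · obtain ⟨c, hc, a, rfl⟩ := exists_circuit_of_forall_relation_eq_smul v
        (fun j => by
          by_cases hjs : j ∈ s
          exacts [hw0 j hjs, (hws j hjs).ge]) hw (hzero i hi) hrel
      exact Submodule.smul_mem _ _ (Submodule.subset_span hc)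
    push Not at hrel
    obtain ⟨h, hhs, hh, hne⟩ : ∃ h : Fin n → ℝ, (∀ j ∉ s, h j = 0) ∧
        ∑ j, h j • toReal (v j) = 0 ∧ (∃ j ∈ s, 0 < h j) ∧ ∀ a : ℝ, h ≠ a • w := by
      obtain ⟨h, hhs, hh, hne⟩ := hrel
      have hhs' : ∀ j ∉ s, h j = 0 := fun j hj => hhs j (hws j hj)
      obtain ⟨j, hj⟩ : ∃ j, h j ≠ 0 := by
        by_contra! hc
        exact hne 0 (by ext j; simp [hc j])
      have hjs : j ∈ s := by_contra fun hc => hj (hhs' j hc)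
      rcases lt_or_gt_of_ne hj with hlt | hlt
      · refine ⟨-h, fun j hj => by simp [hhs' j hj], by simp [hh], ⟨j, hjs, by simpa using hlt⟩,
          fun a ha => hne (-a) ?_⟩
        rw [neg_smul, ← ha, neg_neg]
      · exact ⟨h, hhs', hh, ⟨j, hjs, hlt⟩, hne⟩
    obtain ⟨hpos, hne⟩ := hne
    obtain ⟨t, hmem, hnn⟩ := reduce h hhs hh hpos
    set w' := w - t • h with hw'
    have hoff : ∀ j ∉ s, w' j = 0 := fun j hj => by simp [hw', hws j hj, hhs j hj]
    obtain ⟨j, hj⟩ : ∃ j, w' j ≠ 0 := by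
      by_contra! hc
      have h1 : w = t • h := sub_eq_zero.1 (funext hc)
      have ht : t ≠ 0 := by
        rintro rfl
        exact hzero i hi (by simp [h1])
      exact hne t⁻¹ (by rw [h1, smul_smul, inv_mul_cancel₀ ht, one_smul])
    -- `w'` is nonnegative, nonzero and of smaller support; subtracting a suitable multiple of it
    -- from `w` kills another coordinate, so both pieces fall under the induction hypothesis.
    obtain ⟨t', hmem', -⟩ := reduce w' hoff
      (by simp [hw', sub_smul, mul_smul, Finset.sum_sub_distrib, ← Finset.smul_sum, hw, hh])
      ⟨j, by_contra fun hc => hj (hoff j hc), lt_of_le_of_ne (hnn j) hj.symm⟩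
    have := Submodule.add_mem _ hmem' (Submodule.smul_mem _ t' hmem)
    rwa [sub_add_cancel] at this

end Circuits

/-! ### Existence of a weight system -/

section Weights

variable {d n : ℕ}

theorem sum_natCast_smul_toReal_eq_zero {v : Fin n → Fin d → ℤ} {g : Fin n → ℕ}
    (h : ∑ j, g j • v j = 0) : ∑ j, (g j : ℝ) • toReal (v j) = 0 := by
  ext k
  have h1 : ∑ j, (g j : ℤ) * v j k = 0 := by simpa [Finset.sum_apply] using congrFun h k
  rw [sum_smul_toReal_apply, Pi.zero_apply]
  exact_mod_cast h1

/-- Integer points that span and satisfy a strictly positive relation carry a system of weights. -/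
theorem exists_weights (v : Fin n → Fin d → ℤ)
    (hspan : Submodule.span ℝ (Set.range fun j => toReal (v j)) = ⊤) {p : Fin n → ℝ}
    (hp : ∀ j, 0 < p j) (hp0 : ∑ j, p j • toReal (v j) = 0) :
    ∃ (r : ℕ) (W : Matrix (Fin r) (Fin n) ℕ), n = r + d ∧ (∀ i, Finset.univ.gcd (W i) = 1) ∧
      (∀ j, ∃ i, W i j ≠ 0) ∧ LinearIndependent ℝ (fun i j => (W i j : ℝ)) ∧
      ∀ i, ∑ j, W i j • v j = 0 ∧
        AffineIndependent ℝ (fun j : {j : Fin n // W i j ≠ 0} => toReal (v j)) := by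
  let R : (Fin n → ℝ) →ₗ[ℝ] (Fin d → ℝ) := Fintype.linearCombination ℝ fun j => toReal (v j)
  have hR : ∀ w, R w = ∑ j, w j • toReal (v j) := fun w => Fintype.linearCombination_apply ..
  have hker : Submodule.span ℝ (circuits v) = LinearMap.ker R := by
    refine le_antisymm (Submodule.span_le.2 ?_) fun w hw => ?_
    · rintro _ ⟨g, rfl, -, hg, -⟩
      rw [SetLike.mem_coe, LinearMap.mem_ker, hR]
      exact sum_natCast_smul_toReal_eq_zero hg
    · rw [LinearMap.mem_ker, hR] at hw
      -- A large multiple of the positive relation makes any relation nonnegative, so nonnegative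
      -- relations span the kernel.
      obtain ⟨t, ht⟩ : ∃ t : ℝ, ∀ j, 0 ≤ w j + t * p j := by
        refine ⟨∑ j, |w j| / p j, fun j => ?_⟩
        have h1 : |w j| / p j ≤ ∑ j, |w j| / p j :=
          Finset.single_le_sum (f := fun j => |w j| / p j)
            (fun j _ => div_nonneg (abs_nonneg _) (hp j).le) (Finset.mem_univ j)
        rw [div_le_iff₀ (hp j)] at h1
        linarith [neg_abs_le (w j)]
      have h1 := mem_span_circuits v Finset.univ (w + t • p) (by simp) (fun j _ => ht j) (by
        simp [add_smul, mul_smul, Finset.sum_add_distrib, ← Finset.smul_sum, hw, hp0])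
      have h2 := mem_span_circuits v Finset.univ p (by simp) (fun j _ => (hp j).le) hp0
      have := Submodule.sub_mem _ h1 (Submodule.smul_mem _ t h2)
      rwa [add_sub_cancel_right] at this
  have hdim : n = Module.finrank ℝ (Submodule.span ℝ (circuits v)) + d := by
    have h1 := R.finrank_range_add_finrank_ker
    have h2 : LinearMap.range R = ⊤ := by rw [Fintype.range_linearCombination, hspan]
    rw [h2, finrank_top, Module.finrank_fin_fun, Module.finrank_fin_fun, ← hker] at h1
    omega
  obtain ⟨f, hf, hfspan, hli⟩ := Submodule.exists_fun_fin_finrank_span_eq ℝ (circuits v)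
  choose W hW hgcd hrel haff using hf
  refine ⟨_, W, hdim, hgcd, fun j => ?_, ?_, fun i => ⟨hrel i, haff i⟩⟩
  -- A zero column would make every relation vanish at `j`, but `p j > 0`.
  · by_contra! hj
    have h1 : Submodule.span ℝ (Set.range f) ≤ LinearMap.ker (LinearMap.proj (R := ℝ) j) := by
      rw [Submodule.span_le]
      rintro _ ⟨i, rfl⟩
      simp [hW, hj i]
    have h2 : p ∈ Submodule.span ℝ (Set.range f) := by
      rw [hfspan, hker, LinearMap.mem_ker, hR, hp0]
    exact (hp j).ne' (by simpa using h1 h2)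
  · have : f = fun i j => (W i j : ℝ) := funext hW
    rwa [← this]

theorem linearIndependent_rat_of_real {r : ℕ} {W : Matrix (Fin r) (Fin n) ℕ}
    (h : LinearIndependent ℝ (fun i j => (W i j : ℝ))) :
    LinearIndependent ℚ (fun (i : Fin r) (j : Fin n) => (W i j : ℚ)) := by
  have h1 := h.restrict_scalars' ℚ
  refine LinearIndependent.of_comp ((Algebra.linearMap ℚ ℝ).compLeft (Fin n)) ?_
  convert h1 using 1
  ext i j
  simp

end Weights

/-! ### The Newton polytope and its lattice points -/

section Newton

variable {r n : ℕ} {W : Matrix (Fin r) (Fin n) ℕ}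

theorem convex_newtonSpace (W : Matrix (Fin r) (Fin n) ℕ) : Convex ℝ (newtonSpace W) := by
  intro x hx y hy a b _ _ hab i
  have h1 := hx i
  have h2 := hy i
  simp only [Pi.add_apply, Pi.smul_apply, smul_eq_mul, mul_add, Finset.sum_add_distrib,
    mul_left_comm _ a, mul_left_comm _ b, ← Finset.mul_sum]
  rw [h1, h2, ← add_mul, hab, one_mul]

theorem newtonPolytope_subset_newtonSpace (W : Matrix (Fin r) (Fin n) ℕ) :
    newtonPolytope W ⊆ newtonSpace W := by
  refine convexHull_min ?_ (convex_newtonSpace W)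
  rintro _ ⟨m, hm, rfl⟩ i
  have h : ((∑ j, W i j * m j : ℕ) : ℝ) = (∑ j, W i j : ℕ) := congrArg _ (hm i)
  push_cast at h
  exact h

theorem nonneg_of_mem_newtonPolytope {x : Fin n → ℝ} (hx : x ∈ newtonPolytope W) : 0 ≤ x := by
  refine convexHull_min (t := Set.Ici 0) ?_ (convex_Ici 0) hx
  rintro _ ⟨m, -, rfl⟩ j
  exact Nat.cast_nonneg _

theorem shift_mono {Γ Γ' : AddSubgroup (Fin n → ℤ)} (h : Γ ≤ Γ') : shift Γ ⊆ shift Γ' :=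
  Set.image_mono h

theorem newtonPolytope_inter_shift {Γ : AddSubgroup (Fin n → ℤ)} (hΓ : Γ ≤ newtonLattice W) :
    newtonPolytope W ∩ shift Γ = {x | x ∈ shift Γ ∧ 0 ≤ x} := by
  refine Set.Subset.antisymm (fun x hx => ⟨hx.2, nonneg_of_mem_newtonPolytope hx.1⟩) ?_
  rintro x ⟨hx, hx0⟩
  refine ⟨subset_convexHull ℝ _ ?_, hx⟩
  obtain ⟨γ, hγ, rfl⟩ := hx
  have h0 : ∀ j, 0 ≤ 1 + γ j := fun j => by
    have := hx0 j
    simp only [Pi.zero_apply, Pi.add_apply, Pi.one_apply, toReal] at this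
    exact_mod_cast this
  have hnat : ∀ j, (((1 + γ j).toNat : ℕ) : ℤ) = 1 + γ j := fun j => Int.toNat_of_nonneg (h0 j)
  refine ⟨fun j => (1 + γ j).toNat, fun i => ?_, ?_⟩
  · have h1 := hΓ hγ i
    zify
    simp only [hnat, mul_add, mul_one, Finset.sum_add_distrib, h1, add_zero]
  · ext j
    have : (((1 + γ j).toNat : ℤ) : ℝ) = ((1 + γ j : ℤ) : ℝ) := by rw [hnat j]
    rw [Int.cast_natCast, Int.cast_add, Int.cast_one] at this
    exact this

theorem isLatticePolytope_newtonPolytope (hcol : ∀ j, ∃ i, W i j ≠ 0) :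
    IsLatticePolytope (shift (newtonLattice W)) (newtonPolytope W) := by
  have hfin : {m : Fin n → ℕ | ∀ i, ∑ j, W i j * m j = ∑ j, W i j}.Finite := by
    refine (Set.finite_Icc 0 fun _ => ∑ i, ∑ j, W i j).subset fun m hm => ⟨zero_le, fun j => ?_⟩
    obtain ⟨i, hi⟩ := hcol j
    calc m j ≤ W i j * m j := Nat.le_mul_of_pos_left _ (Nat.pos_of_ne_zero hi)
      _ ≤ ∑ j, W i j * m j :=
        Finset.single_le_sum (f := fun j => W i j * m j) (fun _ _ => zero_le) (Finset.mem_univ j)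
      _ = ∑ j, W i j := hm i
      _ ≤ ∑ i, ∑ j, W i j :=
        Finset.single_le_sum (f := fun i => ∑ j, W i j) (fun _ _ => zero_le) (Finset.mem_univ i)
  refine ⟨(hfin.image fun m j => (m j : ℝ)).toFinset, ?_, by rw [Set.Finite.coe_toFinset]; rfl⟩
  rw [Set.Finite.coe_toFinset]
  rintro _ ⟨m, hm, rfl⟩
  refine ⟨fun j => (m j : ℤ) - 1, fun i => ?_, ?_⟩
  · have := hm i
    zify at this
    simp [mul_sub, this]
  · ext j
    simp [toReal]

theorem isLatticePolytope_convexHull_newtonPolytope_inter (hcol : ∀ j, ∃ i, W i j ≠ 0)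
    (Γ : AddSubgroup (Fin n → ℤ)) :
    IsLatticePolytope (shift Γ) (convexHull ℝ (newtonPolytope W ∩ shift Γ)) := by
  have hfin : (newtonPolytope W ∩ shift Γ).Finite := by
    obtain hb := (isLatticePolytope_newtonPolytope hcol).isCompact.isBounded
    refine (finite_inter_latticePoints hb).subset (Set.inter_subset_inter_right _ ?_)
    rintro _ ⟨γ, -, rfl⟩
    exact ⟨1 + γ, by ext; simp [toReal]⟩
  exact ⟨hfin.toFinset, by simp, by simp⟩

/-- If `1 + γ` is interior, then `1 + (1 + ε) γ` is still nonnegative, so the integers `γ j` are at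
least `0`. Their weighted sums vanish and every column has a positive weight, hence `γ = 0`. -/
theorem eq_one_of_mem_interiorIn_newtonPolytope (hcol : ∀ j, ∃ i, W i j ≠ 0) {x : Fin n → ℝ}
    (hx : x ∈ shift (newtonLattice W)) (hi : x ∈ interiorIn (newtonSpace W) (newtonPolytope W)) :
    x = 1 := by
  obtain ⟨hxA, hnhds⟩ := hi
  obtain ⟨u, hu, hsub⟩ := mem_nhdsWithin_iff_exists_mem_nhds_inter.1 hnhds
  obtain ⟨γ, hγ, rfl⟩ := hx
  obtain ⟨ε, hε, hm⟩ := exists_pos_add_smul_mem hu (toReal γ)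
  have hsum : ∀ i, ∑ j, (W i j : ℝ) * (γ j : ℝ) = 0 := fun i => by exact_mod_cast hγ i
  have hA : 1 + toReal γ + ε • toReal γ ∈ newtonSpace W := fun i => by
    simp only [Pi.add_apply, Pi.smul_apply, Pi.one_apply, smul_eq_mul, toReal, mul_add, mul_one,
      Finset.sum_add_distrib, mul_left_comm _ ε, ← Finset.mul_sum, hsum]
    simp
  have h0 : ∀ j, 0 ≤ γ j := fun j => by
    have h1 := nonneg_of_mem_newtonPolytope (hsub ⟨hm, hA⟩) j
    simp only [Pi.zero_apply, Pi.add_apply, Pi.smul_apply, Pi.one_apply, smul_eq_mul, toReal] at h1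
    by_contra! hc
    have h2 : (γ j : ℝ) ≤ -1 := by
      have : γ j ≤ -1 := by omega
      exact_mod_cast this
    nlinarith
  have hγ0 : γ = 0 := by
    ext j
    obtain ⟨i, hi⟩ := hcol j
    have h1 := (Finset.sum_eq_zero_iff_of_nonneg fun j _ =>
      mul_nonneg (Nat.cast_nonneg (W i j)) (h0 j)).1 (hγ i) j (Finset.mem_univ j)
    simpa [hi] using h1
  ext j
  simp [hγ0, toReal]

theorem interiorIn_mono {A P Q : Set (Fin n → ℝ)} (h : P ⊆ Q) :
    interiorIn A P ⊆ interiorIn A Q :=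
  fun _ hx => ⟨hx.1, Filter.mem_of_superset hx.2 h⟩

end Newton

/-! ### The affine embedding by pairing with the vertices -/

section Pairing

variable {d r n : ℕ}

/-- The map `y ↦ (1 + v j ⬝ y)ⱼ`. -/
noncomputable def distanceMap (v : Fin n → Fin d → ℤ) : (Fin d → ℝ) →ᵃ[ℝ] (Fin n → ℝ) :=
  AffineMap.const ℝ _ 1 + (Matrix.of fun j => toReal (v j)).mulVecLin.toAffineMap

theorem distanceMap_apply (v : Fin n → Fin d → ℤ) (y : Fin d → ℝ) :
    distanceMap v y = 1 + (Matrix.of fun j => toReal (v j)).mulVecLin y := rfl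

/-- The lattice of the vectors `(v j ⬝ z)ⱼ` with `z` integral. -/
def pairingLattice (v : Fin n → Fin d → ℤ) : AddSubgroup (Fin n → ℤ) :=
  (Matrix.of v).mulVecLin.toAddMonoidHom.range

theorem distanceMap_toReal (v : Fin n → Fin d → ℤ) (z : Fin d → ℤ) :
    distanceMap v (toReal z) = 1 + toReal ((Matrix.of v).mulVecLin z) := by
  rw [distanceMap_apply]
  congr 1
  ext j
  exact toReal_dotProduct (v j) z

theorem distanceMap_image_latticePoints (v : Fin n → Fin d → ℤ) :
    distanceMap v '' latticePoints d = shift (pairingLattice v) := by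
  ext x
  constructor
  · rintro ⟨_, ⟨z, rfl⟩, rfl⟩
    exact ⟨_, ⟨z, rfl⟩, (distanceMap_toReal v z).symm⟩
  · rintro ⟨_, ⟨z, rfl⟩, rfl⟩
    exact ⟨_, ⟨z, rfl⟩, distanceMap_toReal v z⟩

theorem mulVecLin_injective_of_span_eq_top (v : Fin n → Fin d → ℤ)
    (hspan : Submodule.span ℝ (Set.range fun j => toReal (v j)) = ⊤) :
    Function.Injective (Matrix.of fun j => toReal (v j)).mulVecLin := by
  rw [injective_iff_map_eq_zero]
  intro y hy
  have h : Submodule.span ℝ (Set.range fun j => toReal (v j)) ≤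
      LinearMap.ker (dotProductBilin ℝ ℝ y) := by
    rw [Submodule.span_le]
    rintro _ ⟨j, rfl⟩
    have : toReal (v j) ⬝ᵥ y = 0 := congrFun hy j
    rw [SetLike.mem_coe, LinearMap.mem_ker]
    exact (dotProduct_comm _ _).trans this
  rw [hspan] at h
  exact dotProduct_self_eq_zero.1 (h (Submodule.mem_top (x := y)))

theorem pairingLattice_le_newtonLattice {v : Fin n → Fin d → ℤ} {W : Matrix (Fin r) (Fin n) ℕ}
    (hrel : ∀ i, ∑ j, W i j • v j = 0) : pairingLattice v ≤ newtonLattice W := by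
  rintro _ ⟨z, rfl⟩ i
  have h : (∑ j, W i j • v j) ⬝ᵥ z = 0 := by rw [hrel i, zero_dotProduct]
  rw [sum_dotProduct] at h
  rw [← h]
  refine Finset.sum_congr rfl fun j _ => ?_
  rw [smul_dotProduct, nsmul_eq_mul]
  rfl

/-- The range of the pairing map lies in the kernel of `W`, and both have dimension `d = n - r`. -/
theorem exists_distanceMap_eq_of_mem_newtonSpace {v : Fin n → Fin d → ℤ}
    {W : Matrix (Fin r) (Fin n) ℕ} (hdim : n = r + d)
    (hspan : Submodule.span ℝ (Set.range fun j => toReal (v j)) = ⊤)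
    (hli : LinearIndependent ℝ (fun i j => (W i j : ℝ)))
    (hrel : ∀ i, ∑ j, W i j • v j = 0) {x : Fin n → ℝ} (hx : x ∈ newtonSpace W) :
    ∃ y, distanceMap v y = x := by
  set L := (Matrix.of fun j => toReal (v j)).mulVecLin with hL
  set K := (Matrix.of fun i j => (W i j : ℝ)).mulVecLin with hK
  have hle : LinearMap.range L ≤ LinearMap.ker K := by
    rintro _ ⟨y, rfl⟩
    rw [LinearMap.mem_ker]
    ext i
    have h : (∑ j, (W i j : ℝ) • toReal (v j)) ⬝ᵥ y = 0 := by
      rw [sum_natCast_smul_toReal_eq_zero (hrel i), zero_dotProduct]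
    rw [sum_dotProduct] at h
    rw [Pi.zero_apply, ← h]
    change ∑ j, (W i j : ℝ) * L y j = _
    refine Finset.sum_congr rfl fun j _ => ?_
    rw [smul_dotProduct, smul_eq_mul]
    rfl
  have heq : LinearMap.range L = LinearMap.ker K := by
    refine Submodule.eq_of_le_of_finrank_eq hle ?_
    have h1 := LinearMap.finrank_range_of_inj (mulVecLin_injective_of_span_eq_top v hspan)
    have h2 := K.finrank_range_add_finrank_ker
    have h3 : (Matrix.of fun i j => (W i j : ℝ)).rank = Fintype.card (Fin r) := hli.rank_matrix
    rw [Matrix.rank, ← hK, Fintype.card_fin] at h3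
    rw [h3, Module.finrank_fin_fun] at h2
    rw [h1, Module.finrank_fin_fun]
    omega
  have hmem : x - 1 ∈ LinearMap.ker K := by
    rw [LinearMap.mem_ker]
    ext i
    have h1 := hx i
    have : K (x - 1) i = ∑ j, (W i j : ℝ) * (x j - 1) := rfl
    rw [this]
    simp [mul_sub, Finset.sum_sub_distrib, h1]
  rw [← heq] at hmem
  obtain ⟨y, hy⟩ := hmem
  exact ⟨y, by rw [distanceMap_apply, ← hL, hy, add_sub_cancel]⟩

theorem distanceMap_image_mem_nhdsWithin {v : Fin n → Fin d → ℤ}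
    {W : Matrix (Fin r) (Fin n) ℕ} (hdim : n = r + d)
    (hspan : Submodule.span ℝ (Set.range fun j => toReal (v j)) = ⊤)
    (hli : LinearIndependent ℝ (fun i j => (W i j : ℝ)))
    (hrel : ∀ i, ∑ j, W i j • v j = 0) {M : Set (Fin d → ℝ)} (hM : M ∈ 𝓝 0) :
    distanceMap v '' M ∈ 𝓝[newtonSpace W] 1 := by
  obtain ⟨g, hg⟩ := LinearMap.exists_leftInverse_of_injective _
    (LinearMap.ker_eq_bot.2 (mulVecLin_injective_of_span_eq_top v hspan))
  have hcont : Continuous fun x : Fin n → ℝ => g (x - 1) :=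
    g.continuous_of_finiteDimensional.comp (continuous_id.sub continuous_const)
  have h1 : (fun x : Fin n → ℝ => g (x - 1)) ⁻¹' M ∈ 𝓝 1 :=
    hcont.continuousAt.preimage_mem_nhds (by simpa using hM)
  refine mem_nhdsWithin_iff_exists_mem_nhds_inter.2 ⟨_, h1, ?_⟩
  rintro x ⟨hx, hxA⟩
  obtain ⟨y, rfl⟩ := exists_distanceMap_eq_of_mem_newtonSpace hdim hspan hli hrel hxA
  refine ⟨y, ?_, rfl⟩
  have h2 := LinearMap.congr_fun hg y
  simp only [Set.mem_preimage, distanceMap_apply, add_sub_cancel_left] at hx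
  rw [LinearMap.comp_apply, LinearMap.id_apply] at h2
  rwa [h2] at hx

/-- Membership in the polar means nonnegative image coordinates, and `Δ(W)` contains every
nonnegative point of the shifted lattice. -/
theorem distanceMap_image_ipDual {v : Fin n → Fin d → ℤ} {W : Matrix (Fin r) (Fin n) ℕ}
    (hrel : ∀ i, ∑ j, W i j • v j = 0) :
    distanceMap v '' ipDual (convexHull ℝ (Set.range fun j => toReal (v j))) =
      convexHull ℝ (newtonPolytope W ∩ shift (pairingLattice v)) := by
  rw [ipDual, AffineMap.image_convexHull,
    newtonPolytope_inter_shift (pairingLattice_le_newtonLattice hrel), polar_convexHull]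
  congr 1
  have key : ∀ y, y ∈ polar (Set.range fun j => toReal (v j)) ↔ 0 ≤ distanceMap v y := fun y => by
    have : ∀ j, distanceMap v y j = 1 + y ⬝ᵥ toReal (v j) := fun j =>
      congrArg (1 + ·) (dotProduct_comm (toReal (v j)) y)
    simp [polar, Pi.le_def, this, neg_le_iff_add_nonneg']
  ext x
  rw [← distanceMap_image_latticePoints]
  constructor
  · rintro ⟨y, ⟨hy, hyL⟩, rfl⟩
    exact ⟨⟨y, hyL, rfl⟩, (key y).1 hy⟩
  · rintro ⟨⟨y, hyL, rfl⟩, h0⟩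
    exact ⟨y, ⟨(key y).2 h0, hyL⟩, rfl⟩

end Pairing

/-! ### Minimal polytopes and the description of maximal closed polytopes -/

section Minimal

variable {d : ℕ}

/-- A finite set with the origin in the interior of its hull contains the vertex set of a polytope
that is minimal with this property. -/
theorem exists_minimal_subset {s : Finset (Fin d → ℝ)}
    (h : 0 ∈ interior (convexHull ℝ (s : Set (Fin d → ℝ)))) :
    ∃ t ⊆ s, 0 ∈ interior (convexHull ℝ (t : Set (Fin d → ℝ))) ∧
      (convexHull ℝ (t : Set (Fin d → ℝ))).extremePoints ℝ = t ∧
      ∀ u ⊆ t, 0 ∈ interior (convexHull ℝ (u : Set (Fin d → ℝ))) → u = t := by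
  classical
  obtain ⟨t, hts, ht⟩ := exists_minimal_le_of_wellFoundedLT
    (fun t : Finset (Fin d → ℝ) => 0 ∈ interior (convexHull ℝ (t : Set (Fin d → ℝ)))) s h
  have hmin : ∀ u ⊆ t, 0 ∈ interior (convexHull ℝ (u : Set (Fin d → ℝ))) → u = t :=
    fun u hu hu0 => Finset.Subset.antisymm hu (ht.2 hu0 hu)
  refine ⟨t, hts, ht.1, ?_, hmin⟩
  set P := convexHull ℝ (t : Set (Fin d → ℝ)) with hP
  have hsub : P.extremePoints ℝ ⊆ t := extremePoints_convexHull_subset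
  have hfin : (P.extremePoints ℝ).Finite := t.finite_toSet.subset hsub
  have hhull : convexHull ℝ (P.extremePoints ℝ) = P := by
    rw [← (hfin.isCompact_convexHull (𝕜 := ℝ)).isClosed.closure_eq]
    exact closure_convexHull_extremePoints (t.finite_toSet.isCompact_convexHull (𝕜 := ℝ))
      (convex_convexHull ℝ _)
  -- By Krein–Milman the extreme points have the same hull, so minimality leaves no other points in
  -- `t`.
  have := hmin hfin.toFinset (by simpa using hsub)
    (by rw [Set.Finite.coe_toFinset, hhull]; exact ht.1)
  rw [← this, Set.Finite.coe_toFinset]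

theorem exists_minimal_convexHull_ipDual_eq {M : Set (Fin d → ℝ)}
    (hM : Maximal IsIPCClosed M) :
    ∃ s : Finset (Fin d → ℝ), IsMinimalIPPolytope (convexHull ℝ (s : Set (Fin d → ℝ))) ∧
      (s : Set (Fin d → ℝ)) ⊆ latticePoints d ∧
      (convexHull ℝ (s : Set (Fin d → ℝ))).extremePoints ℝ = s ∧
      (1 ≤ d → s.card ≤ 2 * d) ∧ ipDual (convexHull ℝ (s : Set (Fin d → ℝ))) = M := by
  have hN := hM.1.1.isIPCClosed_ipDual.1
  have hM0 := hM.1.1.1.zero_mem_interior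
  set X := (finite_polar_inter hM0).toFinset with hX
  have hXN : convexHull ℝ (X : Set (Fin d → ℝ)) = ipDual M := by simp [hX, ipDual]
  obtain ⟨t, htX, ht0, hext, hmin⟩ := exists_minimal_subset (s := X)
    (hXN ▸ hN.1.zero_mem_interior)
  have htL : (t : Set (Fin d → ℝ)) ⊆ latticePoints d := fun x hx => by
    have : x ∈ X := htX hx
    rw [hX, Set.Finite.mem_toFinset] at this
    exact this.2
  have hPN : convexHull ℝ (t : Set (Fin d → ℝ)) ⊆ ipDual M :=
    hXN ▸ convexHull_mono (Finset.coe_subset.2 htX)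
  have hIP : IsIPPolytope (convexHull ℝ (t : Set (Fin d → ℝ))) := by
    refine ⟨⟨t, htL, rfl⟩, Set.Subset.antisymm ?_ ?_⟩
    · rw [← hN.1.2]
      exact Set.inter_subset_inter_left _ (interior_mono hPN)
    · rintro _ rfl
      exact ⟨ht0, zero_mem_latticePoints⟩
  have hMP : M ⊆ ipDual (convexHull ℝ (t : Set (Fin d → ℝ))) := by
    conv_lhs => rw [hM.1.2]
    exact ipDual_anti hPN
  have hconf : IsIPConfined (convexHull ℝ (t : Set (Fin d → ℝ))) :=
    ⟨hIP, isLatticePolytope_ipDual ht0, interior_mono hMP hM0⟩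
  refine ⟨t, ⟨hIP, fun w hw h0 => ?_⟩, htL, hext, fun hd => ?_,
    Set.Subset.antisymm (hM.2 hconf.isIPCClosed_ipDual hMP) hMP⟩
  · classical
    rw [hext] at hw h0
    have := hmin (t.erase w) (Finset.erase_subset _ _) (by rwa [Finset.coe_erase])
    exact Finset.notMem_erase w t (this.symm ▸ hw)
  -- Minimality forces the Steinitz subset to be all of `t`. In dimension zero the bound fails, as
  -- `t` is a single point.
  · have : Nonempty (Fin d) := ⟨⟨0, hd⟩⟩
    obtain ⟨u, hu, hcard, hu0⟩ := exists_subset_card_le_zero_mem_interior_convexHull ht0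
    rwa [hmin u hu hu0, Module.finrank_fin_fun] at hcard

theorem exists_weightMatrix_of_maximal (hd : 1 ≤ d) {M : Set (Fin d → ℝ)}
    (hM : Maximal IsIPCClosed M) :
    ∃ (r n : ℕ) (W : Matrix (Fin r) (Fin n) ℕ) (Γ : AddSubgroup (Fin n → ℤ)),
      IsIPWeightMatrix d W ∧ (W.map (Nat.cast : ℕ → ℚ)).rank ≤ d ∧ Γ ≤ newtonLattice W ∧
      IsIPPolytopeIn (newtonSpace W) (shift Γ) (convexHull ℝ (newtonPolytope W ∩ shift Γ)) ∧
      LatticeEquivalent M Γ (convexHull ℝ (newtonPolytope W ∩ shift Γ)) := by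
  obtain ⟨s, hmin, hsL, hext, hcard, hdual⟩ := exists_minimal_convexHull_ipDual_eq hM
  set n := s.card with hn
  have hlift : ∀ x : s, ∃ z : Fin d → ℤ, toReal z = x := fun x => hsL x.2
  choose z hz using hlift
  set v : Fin n → Fin d → ℤ := fun j => z (s.equivFin.symm j) with hv
  have hvz : ∀ j, toReal (v j) = s.equivFin.symm j := fun j => hz _
  have hrange : Set.range (fun j => toReal (v j)) = s := by
    ext x
    simp only [hvz, Set.mem_range, Finset.mem_coe]
    exact ⟨fun ⟨j, hj⟩ => hj ▸ (s.equivFin.symm j).2, fun hx => ⟨s.equivFin ⟨x, hx⟩, by simp⟩⟩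
  have hinj : Function.Injective v := fun i j hij => by
    have := congrArg toReal hij
    rw [hvz, hvz] at this
    exact s.equivFin.symm.injective (Subtype.ext this)
  have h0 := hmin.1.zero_mem_interior
  have hspan : Submodule.span ℝ (Set.range fun j => toReal (v j)) = ⊤ :=
    hrange ▸ span_eq_top_of_zero_mem_interior_convexHull h0
  obtain ⟨p, hp, hp0⟩ := exists_pos_relation_of_zero_mem_interior_convexHull h0
  obtain ⟨r, W, hdim, hgcd, hcol, hli, hW⟩ := exists_weights v hspan
    (p := fun j => p (s.equivFin.symm j)) (fun j => hp _ (s.equivFin.symm j).2) (by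
      simp only [hvz]
      rw [s.equivFin.symm.sum_comp (fun x : s => p x • (x : Fin d → ℝ)), ← hp0,
        Finset.sum_coe_sort s fun x => p x • x])
  have hrel := fun i => (hW i).1
  have hΓ := pairingLattice_le_newtonLattice hrel
  have himage : distanceMap v '' M = convexHull ℝ (newtonPolytope W ∩ shift (pairingLattice v)) := by
    rw [← distanceMap_image_ipDual hrel, hrange, hdual]
  have hsub : convexHull ℝ (newtonPolytope W ∩ shift (pairingLattice v)) ⊆ newtonPolytope W :=
    convexHull_min Set.inter_subset_left (convex_convexHull ℝ _)
  have hone : ∀ Γ : AddSubgroup (Fin n → ℤ), (1 : Fin n → ℝ) ∈ shift Γ := fun Γ =>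
    ⟨0, Γ.zero_mem, by ext; simp [toReal]⟩
  -- The embedding maps onto `newtonSpace W` with a continuous inverse, so the interior origin of
  -- `M` becomes the interior point `1`.
  have hint : 1 ∈ interiorIn (newtonSpace W)
      (convexHull ℝ (newtonPolytope W ∩ shift (pairingLattice v))) :=
    ⟨fun i => by simp, himage ▸ distanceMap_image_mem_nhdsWithin hdim hspan hli hrel
      (mem_interior_iff_mem_nhds.1 hM.1.1.1.zero_mem_interior)⟩
  refine ⟨r, n, W, pairingLattice v, ⟨⟨hdim, hgcd, hcol, linearIndependent_rat_of_real hli, _, v,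
    hmin, hinj, hrange.trans hext.symm, hW⟩, newtonPolytope_subset_newtonSpace W,
    isLatticePolytope_newtonPolytope hcol, 1, ⟨hone _, interiorIn_mono hsub hint⟩, fun x hx =>
    eq_one_of_mem_interiorIn_newtonPolytope hcol hx.1 hx.2⟩, ?_, hΓ,
    ⟨hsub.trans (newtonPolytope_subset_newtonSpace W),
    isLatticePolytope_convexHull_newtonPolytope_inter hcol _, 1, ⟨hone _, hint⟩, fun x hx =>
    eq_one_of_mem_interiorIn_newtonPolytope hcol (shift_mono hΓ hx.1)
      (interiorIn_mono hsub hx.2)⟩,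
    distanceMap v, ?_, ?_, distanceMap_image_latticePoints v, himage⟩
  -- The rank is at most `r = n - d`, and `n ≤ 2 * d`.
  · have h1 := hcard hd
    have h2 := (W.map (Nat.cast : ℕ → ℚ)).rank_le_height
    omega
  · exact fun x y hxy => mulVecLin_injective_of_span_eq_top v hspan (add_left_cancel hxy)
  · rw [distanceMap_apply, map_zero, add_zero]

end Minimal

end IPC

theorem mainTheorem1 (d : ℕ) (hd : 1 ≤ d) :
    (∀ P : Set (Fin d → ℝ), IPC.IsIPConfined P →
      ∃ M : Set (Fin d → ℝ), Maximal IPC.IsIPCClosed M ∧ P ⊆ M) ∧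
    (∀ P : Set (Fin d → ℝ), IPC.IsReflexive P →
      IPC.IsIPConfined P ∧ ∃ M : Set (Fin d → ℝ), Maximal IPC.IsIPCClosed M ∧ P ⊆ M) ∧
    (∀ M : Set (Fin d → ℝ), Maximal IPC.IsIPCClosed M →
      ∃ (r n : ℕ) (W : Matrix (Fin r) (Fin n) ℕ) (Γ : AddSubgroup (Fin n → ℤ)),
        IPC.IsIPWeightMatrix d W ∧
        (W.map (Nat.cast : ℕ → ℚ)).rank ≤ d ∧
        Γ ≤ IPC.newtonLattice W ∧
        IPC.IsIPPolytopeIn (IPC.newtonSpace W) (IPC.shift Γ)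
          (convexHull ℝ (IPC.newtonPolytope W ∩ IPC.shift Γ)) ∧
        IPC.LatticeEquivalent M Γ (convexHull ℝ (IPC.newtonPolytope W ∩ IPC.shift Γ))) :=
  ⟨fun _ hP => hP.exists_maximal, fun _ hP => ⟨hP.isIPConfined, hP.isIPConfined.exists_maximal⟩,
    fun _ hM => IPC.exists_weightMatrix_of_maximal hd hM⟩
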